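/- Let $\Bbbk$ be a field, $X$ a finite set of variables, $s\in\mathbb N$, and let $\mathcal J_s(X)=\bigcup_{x\in X}\{x_0,\dots,x_s\}$. Simplicial complexes on a vertex set are families of subsets (faces) closed under passing to subsets and containing $\varnothing$; a vertex need not be a face. For a simplicial complex $\Delta$ with vertex set $X$, let $f_i(\Delta)$ be the number of faces with $i+1$ elements, let $f(\Delta)=(f_{-1}(\Delta),f_0(\Delta),f_1(\Delta),\dots)$, extended by infinitely many zeros, and let the Stanley–Reisner ideal of $\Delta$ be the ideal of $\Bbbk[X]$ generated by the squarefree monomials whose support is not a face of $\Delta$. For an ideal $J\subseteq\Bbbk[X]$, let $\mathcal J_s(J)\subseteq\Bbbk[\mathcal J_s(X)]$ be the ideal generated by the coefficients of $1,t,\dots,t^s$ in the polynomials obtained from the elements of $J$ by the substitution $x\mapsto x_0+x_1t+\dots+x_st^s$ $(x\in X)$. For an ideal $I\subseteq\Bbbk[X]$, let $Z=V(I)=\operatorname{Spec}\Bbbk[X]/\sqrt I$ be its reduced vanishing locus, $Z_{\mathrm{sing}}$ the set of points of $Z$ whose local ring is not regular, $\mathcal J_s(Z)=V(\mathcal J_s(\sqrt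 I))\subseteq\operatorname{Spec}\Bbbk[\mathcal J_s(X)]$, and $\pi_s\colon\operatorname{Spec}\Bbbk[\mathcal J_s(X)]\to\operatorname{Spec}\Bbbk[X]$ the projection induced by $x\mapsto x_0$. The ideal of principal $s$-jets of $I$ is $$\mathcal P_s(I)=\mathbb I\left(\overline{\mathcal J_s(Z)\setminus\pi_s^{-1}(Z_{\mathrm{sing}})}\right)\subseteq\Bbbk[\mathcal J_s(X)].$$ Let $L_s$ be the infinite matrix whose entry in row $j\ge 0$ and column $k\ge 0$ is $$\ell_s(j,k)=\sum_{\substack{a\in\mathbb Z_{>0}^j\\ a_1+\dots+a_j=k}}\ \prod_{h=1}^{j}\binom{s+1}{a_h}$$ (the order $s$ lifting matrix). **Theorem.** Let $I\subseteq\Bbbk[X]$ be the Stanley–Reisner ideal of a simplicial complex $\Delta$ with vertex set $X$. Then, for every $s\in\mathbb N$, $\mathcal P_s(I)$ is the Stanley–Reisner ideal of a simplicial complex $\Gamma_s$ with vertex set $\mathcal J_s(X)$ and $f$-vector $$f(\Gamma_s)=f(\Delta)\,L_s,\qquad\text{i.e. } f_{k-1}(\Gamma_s)=\sum_{j\ge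 0}f_{j-1}(\Delta)\,\ell_s(j,k)\quad(k\ge 0).$$ Moreover, the Krull dimension of $\Bbbk[X]/I$ is a natural number $d$ and * $\Bbbk[\mathcal J_s(X)]/\mathcal P_s(I)$ has Krull dimension $(s+1)d$; * $\Bbbk[X]/I$ and $\Bbbk[\mathcal J_s(X)]/\mathcal P_s(I)$ both have multiplicity $f_{d-1}(\Delta)$. Here a standard graded quotient $A$ of a polynomial ring over $\Bbbk$, of Krull dimension $d$, has multiplicity $e$ if its Hilbert series $\sum_i\dim_\Bbbk(A_i)\,t^i$ equals $Q(t)/(1-t)^d$ for a polynomial $Q\in\mathbb Z[t]$ with $Q(1)=e$. -/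

import Mathlib

noncomputable section

namespace PrincipalJets

/-! ### Simplicial complexes, f-vectors, Stanley–Reisner ideals -/

/-- A simplicial complex on the vertex set `X`: a set of finite subsets of `X` (the faces) which is
closed under passing to subsets and contains the empty face.  An element of `X` need not itself be
a face, since every proper squarefree monomial ideal of `𝕜[X]` has to come from a complex on `X`.
(Mathlib's `PreAbstractSimplicialComplex` leaves out the empty face, which counts here.) -/
@[ext]
structure SimplicialComplex (X : Type*) where
  faces : Set (Finset X)
  empty_mem : ∅ ∈ faces
  down_closed : ∀ {F G : Finset X}, F ∈ faces → G ⊆ F → G ∈ faces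

variable {X : Type*}

/-- The `f`-vector of `Δ`, extended by infinitely many zeros.  A face with `i` vertices has
dimension `i - 1`, so the entry in position `i` is the number written `f_{i-1}(Δ)`. -/
def SimplicialComplex.fVector (Δ : SimplicialComplex X) (i : ℕ) : ℕ :=
  {F : Finset X | F ∈ Δ.faces ∧ F.card = i}.ncard

/-- The Stanley–Reisner ideal of `Δ` in `𝕜[X]`: the squarefree monomial ideal generated by the
squarefree monomials whose support is not a face. -/
def SimplicialComplex.stanleyReisnerIdeal (Δ : SimplicialComplex X) (𝕜 : Type*) [Field 𝕜] :
    Ideal (MvPolynomial X 𝕜) :=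
  Ideal.span {m | ∃ F : Finset X, F ∉ Δ.faces ∧ m = ∏ x ∈ F, MvPolynomial.X x}

/-! ### Jets and principal jets -/

/-- The variables `x_0, …, x_s` for `x ∈ X`; the pair `(x, j)` is the variable `x_j`. -/
abbrev JetVar (s : ℕ) (X : Type*) : Type _ := X × Fin (s + 1)

variable {𝕜 : Type*} [Field 𝕜]

/-- The homomorphism `𝕜[X] → 𝕜[J_s(X)][t]`, `x ↦ x_0 + x_1 t + ⋯ + x_s t ^ s`.  Reducing modulo
`t ^ (s + 1)` keeps exactly the coefficients of `1, t, …, t ^ s`. -/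
def jetHom (s : ℕ) : MvPolynomial X 𝕜 →ₐ[𝕜] Polynomial (MvPolynomial (JetVar s X) 𝕜) :=
  MvPolynomial.aeval fun x => ∑ j : Fin (s + 1),
    Polynomial.C (MvPolynomial.X (x, j)) * Polynomial.X ^ (j : ℕ)

/-- The ideal of `s`-jets of `I`, generated by the coefficients of `t ^ j`, `j ≤ s`, of the images
of the elements of `I` under `jetHom`. -/
def jetIdeal (s : ℕ) (I : Ideal (MvPolynomial X 𝕜)) : Ideal (MvPolynomial (JetVar s X) 𝕜) :=
  Ideal.span {g | ∃ f ∈ I, ∃ j ≤ s, g = (jetHom s f).coeff j}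

/-- The ideal of `s`-jets can be computed from any set of generators. -/
theorem jetIdeal_span (s : ℕ) (S : Set (MvPolynomial X 𝕜)) :
    jetIdeal s (Ideal.span S) = Ideal.span {g | ∃ f ∈ S, ∃ j ≤ s, g = (jetHom s f).coeff j} := by
  apply le_antisymm
  · refine Ideal.span_le.2 ?_
    rintro _ ⟨f, hf, j, hj, rfl⟩
    induction hf using Submodule.span_induction generalizing j with
    | mem f hf => exact Ideal.subset_span ⟨f, hf, j, hj, rfl⟩
    | zero => simp
    | add a b _ _ ha hb =>
      rw [map_add, Polynomial.coeff_add]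
      exact Ideal.add_mem _ (ha j hj) (hb j hj)
    | smul a b _ hb =>
      rw [smul_eq_mul, map_mul, Polynomial.coeff_mul]
      refine Ideal.sum_mem _ fun p hp => Ideal.mul_mem_left _ _ (hb p.2 ?_)
      have := Finset.HasAntidiagonal.mem_antidiagonal.1 hp
      omega
  · refine Ideal.span_mono ?_
    rintro _ ⟨f, hf, j, hj, rfl⟩
    exact ⟨f, Ideal.subset_span hf, j, hj, rfl⟩

/-- The singular locus, as a subset of the affine space `Spec 𝕜[X]`, of the (reduced) vanishing
locus `Z = Spec 𝕜[X]/√I` of `I`: the points at which the local ring of `Z` is not regular. -/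
def singularLocus (I : Ideal (MvPolynomial X 𝕜)) : Set (PrimeSpectrum (MvPolynomial X 𝕜)) :=
  PrimeSpectrum.comap (Ideal.Quotient.mk I.radical) ''
    {p | ¬ IsRegularLocalRing (Localization.AtPrime p.asIdeal)}

/-- The projection from the space of `s`-jets of affine space to affine space; it is induced by
the inclusion `𝕜[X] → 𝕜[J_s(X)]`, `x ↦ x_0`. -/
def jetProj (s : ℕ) :
    PrimeSpectrum (MvPolynomial (JetVar s X) 𝕜) → PrimeSpectrum (MvPolynomial X 𝕜) :=
  PrimeSpectrum.comap
    (MvPolynomial.rename (R := 𝕜) fun x : X => ((x, 0) : JetVar s X)).toRingHom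

/-- The jet scheme `J_s(Z)` of the (reduced) vanishing locus `Z` of `I`, as a closed subset of
`Spec 𝕜[J_s(X)]`. -/
def jetLocus (s : ℕ) (I : Ideal (MvPolynomial X 𝕜)) :
    Set (PrimeSpectrum (MvPolynomial (JetVar s X) 𝕜)) :=
  PrimeSpectrum.zeroLocus (jetIdeal s I.radical)

/-- The ideal `P_s(I)` of principal `s`-jets of `I`: the ideal of the Zariski closure of the set of
`s`-jets of the vanishing locus `Z` of `I` which are not supported over the singular locus. -/
def principalJets (s : ℕ) (I : Ideal (MvPolynomial X 𝕜)) :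
    Ideal (MvPolynomial (JetVar s X) 𝕜) :=
  PrimeSpectrum.vanishingIdeal (closure (jetLocus s I \ jetProj s ⁻¹' singularLocus I))

/-! ### The lifting matrix -/

/-- The order `s` lifting function `ℓ_s(j, k)`: the sum over all `j`-tuples `a` of positive
integers with `a_1 + ⋯ + a_j = k` of the products of the binomial coefficients `(s + 1).choose a_h`. -/
def liftingFunction (s j k : ℕ) : ℕ :=
  ∑ a ∈ (Finset.finAntidiagonal j k).filter (fun a => ∀ h, 0 < a h),
    ∏ h : Fin j, (s + 1).choose (a h)

/-- The order `s` lifting matrix, with rows and columns indexed by the natural numbers. -/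
def liftingMatrix (s : ℕ) : Matrix ℕ ℕ ℕ := Matrix.of (liftingFunction s)

/-- The product of an infinite row vector with an infinite matrix.  It is only used for row vectors
with finitely many nonzero entries, see `SimplicialComplex.finite_support_fVector`. -/
def rowMul (v : ℕ → ℕ) (L : Matrix ℕ ℕ ℕ) (k : ℕ) : ℕ := ∑ᶠ j, v j * L j k

theorem SimplicialComplex.finite_support_fVector [Finite X] (Δ : SimplicialComplex X) :
    (Function.support Δ.fVector).Finite := by
  refine (Set.finite_range (Finset.card : Finset X → ℕ)).subset fun i hi => ?_
  obtain ⟨F, -, hF⟩ := Set.nonempty_of_ncard_ne_zero hi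
  exact ⟨F, hF⟩

/-! ### Hilbert series and multiplicity -/

/-- For a homogeneous ideal `I`, the dimension over `𝕜` of the graded component of degree `i` of
`𝕜[X]/I` in the standard grading. -/
def hilbertFunction (I : Ideal (MvPolynomial X 𝕜)) (i : ℕ) : ℕ :=
  Module.finrank 𝕜 ((MvPolynomial.homogeneousSubmodule X 𝕜 i).map
    (Ideal.Quotient.mkₐ 𝕜 I).toLinearMap)

/-- The Hilbert series of `𝕜[X]/I`. -/
def hilbertSeries (I : Ideal (MvPolynomial X 𝕜)) : PowerSeries ℤ :=
  PowerSeries.mk fun i => (hilbertFunction I i : ℤ)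

/-- `𝕜[X]/I` has multiplicity `e`: its Hilbert series is `Q(t) / (1 - t) ^ d`, where `d` is the
Krull dimension and `Q` is a polynomial with integer coefficients, and `e = Q(1)`. -/
def HasMultiplicity (I : Ideal (MvPolynomial X 𝕜)) (e : ℕ) : Prop :=
  ∃ d : ℕ, ringKrullDim (MvPolynomial X 𝕜 ⧸ I) = d ∧
    ∃ Q : Polynomial ℤ, hilbertSeries I * (1 - PowerSeries.X) ^ d = (Q : PowerSeries ℤ) ∧
      Q.eval 1 = e

/-- The multiplicity is unique. -/
theorem HasMultiplicity.unique {I : Ideal (MvPolynomial X 𝕜)} {e e' : ℕ}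
    (h : HasMultiplicity I e) (h' : HasMultiplicity I e') : e = e' := by
  obtain ⟨d, hd, Q, hQ, he⟩ := h
  obtain ⟨d', hd', Q', hQ', he'⟩ := h'
  have hdd : d = d' := by exact_mod_cast hd.symm.trans hd'
  subst hdd
  have hQQ : Q = Q' := Polynomial.coe_injective ℤ (hQ.symm.trans hQ')
  subst hQQ
  exact_mod_cast he.symm.trans he'

end PrincipalJets

end

-- `Z` is a union of coordinate subspaces, one for each face of Δ, with the facets as components. A
-- regular local ring is a domain, so near a regular point `Z` coincides with a single coordinate
-- subspace, and a jet based there has `x_0, …, x_s` all zero for every `x` outside some face `F`.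
-- Conversely, the generic point of the subspace of a facet is regular on `Z`, and the jets of that
-- subspace form a coordinate subspace of the jet space. Hence `P_s(I)` is the intersection of the
-- primes of these larger subspaces, and Γ consists of the sets of jet variables whose projection to
-- `X` is a face (`principalJets_stanleyReisnerIdeal`).
--
-- A face of Γ projecting onto `F` amounts to a nonempty subset of `{0, …, s}` for each element of
-- `F`; these are counted by `ℓ_s(|F|, k)`. Dimension and multiplicity of a Stanley–Reisner ring are
-- the size and the number of its largest faces, and the largest faces of Γ are the full preimages
-- of those of Δ.

universe u

noncomputable section

/-! ### Regular local rings are domains -/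

namespace PrincipalJets
open IsLocalRing

/-- A Noetherian local ring whose maximal ideal has a generating set with at most `dim R` elements
is a domain. -/
theorem isDomain_of_span_eq_maximalIdeal (n : ℕ) : ∀ (R : Type u) [CommRing R] [IsLocalRing R]
    [IsNoetherianRing R] (S : Finset R), Ideal.span (S : Set R) = maximalIdeal R → S.card ≤ n →
    (n : WithBot ℕ∞) ≤ ringKrullDim R → IsDomain R := by
  induction n with
  | zero =>
    intro R _ _ _ S hS hn _
    have hS' : S = ∅ := Finset.card_eq_zero.1 (Nat.le_zero.1 hn)
    subst hS'
    rw [Finset.coe_empty, Ideal.span_empty] at hS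
    exact (isField_iff_maximalIdeal_eq.2 hS.symm).isDomain
  | succ n ih =>
    classical
    intro R _ _ _ S hS hn hd
    have hpos : ¬ ringKrullDim R ≤ 0 := fun h => by
      have h' : (((n + 1 : ℕ) : ℕ∞) : WithBot ℕ∞) ≤ ((0 : ℕ∞) : WithBot ℕ∞) := hd.trans h
      rw [WithBot.coe_le_coe] at h'
      simp at h'
    -- Prime avoidance, with `m ^ 2` as the one ideal allowed not to be prime. Avoiding `m ^ 2` lets
    -- `x` replace a generator; avoiding the minimal primes makes the final Nakayama argument work.
    obtain ⟨x, hxm, hx⟩ : ∃ x ∈ maximalIdeal R,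
        x ∉ ⋃ P ∈ insert (maximalIdeal R ^ 2) (minimalPrimes R), (P : Set R) := by
      by_contra! hcon
      obtain ⟨P, hP, hle⟩ := (Ideal.subset_union_prime_finite (f := fun P : Ideal R => P)
        ((minimalPrimes.finite_of_isNoetherianRing R).insert (maximalIdeal R ^ 2))
        (maximalIdeal R ^ 2) (maximalIdeal R ^ 2) (by
          intro P hP hne _
          exact (hP.resolve_left hne).1.1)).1 hcon
      rcases hP with rfl | hP
      · have hbot : maximalIdeal R = ⊥ := by
          refine Submodule.eq_bot_of_le_smul_of_le_jacobson_bot (maximalIdeal R) _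
            (IsNoetherian.noetherian _) ?_ (maximalIdeal_le_jacobson _)
          rwa [smul_eq_mul, ← pow_two]
        exact hpos (ringKrullDim_eq_zero_of_isField (isField_iff_maximalIdeal_eq.2 hbot)).le
      · have hPp : P.IsPrime := hP.1.1
        have heq : maximalIdeal R = P := le_antisymm hle (le_maximalIdeal hPp.ne_top)
        refine hpos ?_
        rw [← maximalIdeal_height_eq_ringKrullDim, heq, Ideal.height_eq_zero_iff.2 hP]
        rfl
    simp only [Set.mem_iUnion, Set.mem_insert_iff, SetLike.mem_coe, exists_prop, not_exists,
      not_and] at hx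
    have hx2 : x ∉ maximalIdeal R ^ 2 := hx _ (Or.inl rfl)
    obtain ⟨a, -, ha⟩ := Submodule.mem_span_finset.1 (show x ∈ Ideal.span (S : Set R) by
      rwa [hS])
    have hSm : ∀ y ∈ S, y ∈ maximalIdeal R := fun y hy => hS ▸ Ideal.subset_span hy
    -- Since `x ∉ m ^ 2`, some coefficient is a unit, so `y` becomes redundant modulo `x`.
    obtain ⟨y, hyS, hy⟩ : ∃ y ∈ S, a y ∉ maximalIdeal R := by
      by_contra! hcon
      refine hx2 (ha ▸ Ideal.sum_mem _ fun y hy => ?_)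
      rw [pow_two]
      exact Ideal.mul_mem_mul (hcon y hy) (hSm y hy)
    have hunit : IsUnit (a y) := by simpa using hy
    set J := Ideal.span ({x} : Set R) with hJ
    have hxJ : x ∈ J := Ideal.mem_span_singleton_self x
    have hJm : J ≤ maximalIdeal R := (Ideal.span_singleton_le_iff_mem _).2 hxm
    have : Nontrivial (R ⧸ J) := Ideal.Quotient.nontrivial_iff.2 fun h =>
      (maximalIdeal.isMaximal R).ne_top (top_le_iff.1 (h ▸ hJm))
    have : IsLocalRing (R ⧸ J) := IsLocalRing.of_surjective' _ Ideal.Quotient.mk_surjective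
    have hmap : maximalIdeal (R ⧸ J) = (maximalIdeal R).map (Ideal.Quotient.mk J) := by
      symm
      refine eq_maximalIdeal ((Ideal.map_eq_top_or_isMaximal_of_surjective _
        Ideal.Quotient.mk_surjective (maximalIdeal.isMaximal R)).resolve_left fun h => ?_)
      refine (maximalIdeal.isMaximal R).ne_top (top_le_iff.1 ?_)
      rw [← Ideal.comap_top (f := Ideal.Quotient.mk J), ← h,
        Ideal.comap_map_of_surjective _ Ideal.Quotient.mk_surjective, ← RingHom.ker_eq_comap_bot,
        Ideal.mk_ker, sup_eq_left.2 hJm]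
    have hdom : IsDomain (R ⧸ J) := by
      refine ih (R ⧸ J) ((S.erase y).image (Ideal.Quotient.mk J)) ?_ ?_ ?_
      · rw [hmap, ← hS, Ideal.map_span, Finset.coe_image]
        refine le_antisymm (Ideal.span_mono (Set.image_mono (by simp))) (Ideal.span_le.2 ?_)
        rintro _ ⟨z, hz, rfl⟩
        by_cases hzy : z = y
        · subst hzy
          have h0 : Ideal.Quotient.mk J (a z) * Ideal.Quotient.mk J z =
              - ∑ w ∈ S.erase z, Ideal.Quotient.mk J (a w) * Ideal.Quotient.mk J w := by
            rw [eq_neg_iff_add_eq_zero, Finset.add_sum_erase S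
              (fun w => Ideal.Quotient.mk J (a w) * Ideal.Quotient.mk J w) hyS]
            simp_rw [← map_mul, ← map_sum]
            rw [Ideal.Quotient.eq_zero_iff_mem]
            simp_rw [smul_eq_mul] at ha
            rwa [ha]
          have hu : IsUnit (Ideal.Quotient.mk J (a z)) := hunit.map _
          rw [SetLike.mem_coe, ← Ideal.unit_mul_mem_iff_mem _ hu, h0]
          exact neg_mem (Ideal.sum_mem _ fun w hw => Ideal.mul_mem_left _ _
            (Ideal.subset_span ⟨w, hw, rfl⟩))
        · exact Ideal.subset_span ⟨z, by simpa [hzy] using hz, rfl⟩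
      · refine Finset.card_image_le.trans ?_
        rw [Finset.card_erase_of_mem hyS]
        omega
      · have h1 := ringKrullDim_le_ringKrullDim_quotient_add_card (s := {x}) (R := R)
          (by rw [ringJacobson_eq_maximalIdeal]; simpa using hxm)
        rw [Finset.coe_singleton, Finset.card_singleton, ← hJ] at h1
        have h2 := hd.trans h1
        push_cast at h2
        exact ENat.WithBot.add_le_add_one_right_iff.1 h2
    have hJp : J.IsPrime := (Ideal.Quotient.isDomain_iff_prime J).1 hdom
    -- An element of `P ≤ (x)` is `w * x` with `w ∈ P`, because `x ∉ P`. Thus `P = x P`, and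
    -- Nakayama gives `P = 0`.
    obtain ⟨P, hP, hPJ⟩ := Ideal.exists_minimalPrimes_le (bot_le (a := J))
    have hPp : P.IsPrime := hP.1.1
    have hxP : x ∉ P := hx P (Or.inr hP)
    have hbot : P = ⊥ := by
      refine Submodule.eq_bot_of_le_smul_of_le_jacobson_bot J _
        (IsNoetherian.noetherian _) (fun z hz => ?_) (hJm.trans (maximalIdeal_le_jacobson _))
      obtain ⟨w, rfl⟩ := Ideal.mem_span_singleton'.1 (hPJ hz)
      rw [mul_comm]
      exact Submodule.smul_mem_smul hxJ ((hPp.mem_or_mem hz).resolve_right hxP)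
    rw [hbot] at hPp
    exact IsDomain.of_bot_isPrime R

theorem _root_.IsRegularLocalRing.isDomain (R : Type u) [CommRing R] [IsRegularLocalRing R] :
    IsDomain R := by
  obtain ⟨S, hcard, hS⟩ :=
    (IsNoetherian.noetherian (maximalIdeal R)).exists_span_finset_card_eq_spanFinrank
  exact isDomain_of_span_eq_maximalIdeal _ R S hS hcard.le
    (IsRegularLocalRing.spanFinrank_maximalIdeal (R := R)).le

end PrincipalJets

namespace PrincipalJets
open MvPolynomial

/-! ### Stanley–Reisner ideals and coordinate subspaces -/

section StanleyReisner
variable {σ : Type*} (𝕜 : Type*) [Field 𝕜]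

/-- The ideal of the coordinate subspace spanned by the coordinates in `F`. -/
def faceIdeal (F : Finset σ) : Ideal (MvPolynomial σ 𝕜) :=
  Ideal.span (X '' {x | x ∉ F})

variable {𝕜}

theorem mem_faceIdeal_iff {F : Finset σ} {f : MvPolynomial σ 𝕜} :
    f ∈ faceIdeal 𝕜 F ↔ ∀ m ∈ f.support, ¬ m.support ⊆ F := by
  rw [faceIdeal, mem_ideal_span_X_image]
  refine forall₂_congr fun m _ => ?_
  simp only [Finset.subset_iff, Finsupp.mem_support_iff, Set.mem_ofPred_eq, not_forall, exists_prop]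
  exact exists_congr fun _ => and_comm

theorem X_mem_faceIdeal_iff {F : Finset σ} {x : σ} :
    (X x : MvPolynomial σ 𝕜) ∈ faceIdeal 𝕜 F ↔ x ∉ F := by
  rw [mem_faceIdeal_iff, support_X]
  simp [Finsupp.support_single]

/-- A monomial ideal is tested monomial by monomial, and the squarefree monomial of `F` divides `x ^
m` exactly when `F ⊆ m.support`. -/
theorem mem_stanleyReisnerIdeal_iff {Δ : SimplicialComplex σ} {f : MvPolynomial σ 𝕜} :
    f ∈ Δ.stanleyReisnerIdeal 𝕜 ↔ ∀ m ∈ f.support, m.support ∉ Δ.faces := by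
  have hgen : {m : MvPolynomial σ 𝕜 | ∃ F : Finset σ, F ∉ Δ.faces ∧ m = ∏ x ∈ F, X x} =
      (fun m => monomial m (1 : 𝕜)) '' {m | ∃ F : Finset σ, F ∉ Δ.faces ∧
        m = ∑ x ∈ F, Finsupp.single x 1} := by
    ext m
    constructor
    · rintro ⟨F, hF, rfl⟩
      exact ⟨_, ⟨F, hF, rfl⟩, by simp [monomial_sum_one, X]⟩
    · rintro ⟨_, ⟨F, hF, rfl⟩, rfl⟩
      exact ⟨F, hF, by simp [monomial_sum_one, X]⟩
  rw [SimplicialComplex.stanleyReisnerIdeal, hgen, mem_ideal_span_monomial_image]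
  refine forall₂_congr fun m _ => ?_
  classical
  have hle : ∀ F : Finset σ, (∑ x ∈ F, Finsupp.single x 1) ≤ m ↔ F ⊆ m.support := fun F => by
    rw [Finsupp.le_def, Finset.subset_iff]
    refine forall_congr' fun x => ?_
    simp only [Finsupp.finsetSum_apply, Finsupp.single_apply, Finset.sum_ite_eq',
      Finsupp.mem_support_iff]
    split_ifs with hx <;> simp [hx, Nat.one_le_iff_ne_zero]
  constructor
  · rintro ⟨_, ⟨F, hF, rfl⟩, h⟩ hm
    exact hF (Δ.down_closed hm ((hle F).1 h))
  · exact fun hm => ⟨_, ⟨m.support, hm, rfl⟩, (hle _).2 subset_rfl⟩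

theorem stanleyReisnerIdeal_le_faceIdeal {Δ : SimplicialComplex σ} {F : Finset σ}
    (hF : F ∈ Δ.faces) : Δ.stanleyReisnerIdeal 𝕜 ≤ faceIdeal 𝕜 F := fun _ hf =>
  mem_faceIdeal_iff.2 fun m hm h =>
    mem_stanleyReisnerIdeal_iff.1 hf m hm (Δ.down_closed hF h)

theorem mem_stanleyReisnerIdeal_iff_forall_faceIdeal {Δ : SimplicialComplex σ}
    {f : MvPolynomial σ 𝕜} :
    f ∈ Δ.stanleyReisnerIdeal 𝕜 ↔ ∀ F ∈ Δ.faces, f ∈ faceIdeal 𝕜 F :=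
  ⟨fun hf _ hF => stanleyReisnerIdeal_le_faceIdeal hF hf, fun h =>
    mem_stanleyReisnerIdeal_iff.2 fun m hm hface => mem_faceIdeal_iff.1 (h _ hface) m hm subset_rfl⟩

theorem ker_killCompl (F : Finset σ) :
    RingHom.ker (killCompl (R := 𝕜) (Subtype.val_injective (p := (· ∈ F)))) = faceIdeal 𝕜 F := by
  classical
  have hX : ∀ x, killCompl (R := 𝕜) (Subtype.val_injective (p := (· ∈ F))) (X x) =
      if h : x ∈ F then X ⟨x, h⟩ else 0 := fun x => by
    by_cases h : x ∈ F
    · have := killCompl_rename_app (R := 𝕜) (Subtype.val_injective (p := (· ∈ F))) (X ⟨x, h⟩)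
      rw [rename_X] at this
      rw [this, dif_pos h]
    · simp [killCompl, h]
  refine le_antisymm (fun f hf => ?_) (Ideal.span_le.2 ?_)
  -- Killing the variables outside `F` does not change a polynomial modulo `faceIdeal 𝕜 F`.
  · have key : (Ideal.Quotient.mkₐ 𝕜 (faceIdeal 𝕜 F)).comp
        ((rename Subtype.val).comp (killCompl (Subtype.val_injective (p := (· ∈ F))))) =
        Ideal.Quotient.mkₐ 𝕜 (faceIdeal 𝕜 F) := by
      refine algHom_ext fun x => ?_
      simp only [AlgHom.comp_apply, hX]
      split_ifs with h
      · simp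
      · rw [map_zero, map_zero, eq_comm, Ideal.Quotient.mkₐ_eq_mk, Ideal.Quotient.eq_zero_iff_mem]
        exact X_mem_faceIdeal_iff.2 h
    have h := DFunLike.congr_fun key f
    rw [AlgHom.comp_apply, AlgHom.comp_apply, (RingHom.mem_ker).1 hf, map_zero, map_zero,
      eq_comm, Ideal.Quotient.mkₐ_eq_mk, Ideal.Quotient.eq_zero_iff_mem] at h
    exact h
  · rintro _ ⟨x, hx, rfl⟩
    rw [SetLike.mem_coe, RingHom.mem_ker, hX, dif_neg hx]

theorem killCompl_surjective (F : Finset σ) :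
    Function.Surjective (killCompl (R := 𝕜) (Subtype.val_injective (p := (· ∈ F)))) := fun f =>
  ⟨rename Subtype.val f, killCompl_rename_app _ f⟩

/-- The coordinate ring of a coordinate subspace is a polynomial ring. -/
def quotientFaceIdealEquiv (F : Finset σ) :
    (MvPolynomial σ 𝕜 ⧸ faceIdeal 𝕜 F) ≃+* MvPolynomial F 𝕜 :=
  (Ideal.quotEquivOfEq (ker_killCompl F).symm).trans
    (RingHom.quotientKerEquivOfSurjective (killCompl_surjective F))

instance isPrime_faceIdeal (F : Finset σ) : (faceIdeal 𝕜 F).IsPrime :=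
  (Ideal.Quotient.isDomain_iff_prime _).1 (quotientFaceIdealEquiv F).toMulEquiv.isDomain

theorem isRadical_stanleyReisnerIdeal (Δ : SimplicialComplex σ) :
    (Δ.stanleyReisnerIdeal 𝕜).IsRadical := fun f hf => by
  obtain ⟨n, hn⟩ := hf
  refine mem_stanleyReisnerIdeal_iff_forall_faceIdeal.2 fun F hF => ?_
  exact (isPrime_faceIdeal F).mem_of_pow_mem n
    (mem_stanleyReisnerIdeal_iff_forall_faceIdeal.1 hn F hF)

/-- Take for `F` the variables not in `p`: were it a nonface, their product would lie in the prime
`p`. -/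
theorem exists_faceIdeal_le [Finite σ] {Δ : SimplicialComplex σ} {p : Ideal (MvPolynomial σ 𝕜)}
    (hp : p.IsPrime) (h : Δ.stanleyReisnerIdeal 𝕜 ≤ p) : ∃ F ∈ Δ.faces, faceIdeal 𝕜 F ≤ p := by
  classical
  have := Fintype.ofFinite σ
  refine ⟨Finset.univ.filter fun x => (X x : MvPolynomial σ 𝕜) ∉ p, ?_, Ideal.span_le.2 ?_⟩
  · by_contra hF
    obtain ⟨x, hx, hxp⟩ := (hp.prod_mem_iff).1 (h (Ideal.subset_span ⟨_, hF, rfl⟩))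
    exact (Finset.mem_filter.1 hx).2 hxp
  · rintro _ ⟨x, hx, rfl⟩
    simpa using hx

theorem exists_facet [Finite σ] {Δ : SimplicialComplex σ} {F : Finset σ} (hF : F ∈ Δ.faces) :
    ∃ G, F ⊆ G ∧ Maximal (· ∈ Δ.faces) G :=
  (Set.toFinite Δ.faces).exists_le_maximal hF

end StanleyReisner

/-! ### Jets over the regular locus -/

section Jets
variable {σ : Type*} {𝕜 : Type*} [Field 𝕜] {s : ℕ}

theorem jetHom_X (x : σ) : jetHom (𝕜 := 𝕜) s (X x) = ∑ j : Fin (s + 1),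
    Polynomial.C (X (x, j)) * Polynomial.X ^ (j : ℕ) := by
  rw [jetHom, aeval_X]

theorem coeff_jetHom_X (x : σ) (j : Fin (s + 1)) :
    (jetHom (𝕜 := 𝕜) s (X x)).coeff j = X (x, j) := by
  rw [jetHom_X, Polynomial.finsetSum_coeff]
  simp_rw [Polynomial.coeff_C_mul_X_pow, Fin.val_inj]
  simp

theorem coeff_zero_jetHom (f : MvPolynomial σ 𝕜) :
    (jetHom s f).coeff 0 = rename (fun x => ((x, 0) : JetVar s σ)) f := by
  have h : (Polynomial.constantCoeff : _ →+* MvPolynomial (JetVar s σ) 𝕜).comp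
      (jetHom (𝕜 := 𝕜) (X := σ) s).toRingHom =
      (rename (fun x => ((x, 0) : JetVar s σ))).toRingHom := by
    refine ringHom_ext (fun r => ?_) fun x => ?_
    · have h1 : jetHom (𝕜 := 𝕜) (X := σ) s (C r) = algebraMap 𝕜 _ r :=
        (jetHom s).commutes r
      simp [h1, Polynomial.algebraMap_apply, MvPolynomial.algebraMap_eq]
    · simpa using coeff_jetHom_X (𝕜 := 𝕜) x (0 : Fin (s + 1))
  exact DFunLike.congr_fun h f

/-- If `g * x` is in the ideal and `g` does not vanish at the base point of a jet, then `x`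
vanishes along the jet. -/
theorem X_mem_of_mul_mem {I : Ideal (MvPolynomial σ 𝕜)} {q : Ideal (MvPolynomial (JetVar s σ) 𝕜)}
    [q.IsPrime] (hq : jetIdeal s I ≤ q) {g : MvPolynomial σ 𝕜} {x : σ} (hgx : g * X x ∈ I)
    (hg : rename (fun x => ((x, 0) : JetVar s σ)) g ∉ q) (j : Fin (s + 1)) :
    X (x, j) ∈ q := by
  suffices h : ∀ i ≤ s, (jetHom (𝕜 := 𝕜) s (X x)).coeff i ∈ q by
    rw [← coeff_jetHom_X]
    exact h j (Nat.lt_succ_iff.1 j.2)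
  intro i
  induction i using Nat.strong_induction_on with
  | _ i ih =>
    intro hi
    have hmem : (jetHom s (g * X x)).coeff i ∈ q :=
      hq (Ideal.subset_span ⟨_, hgx, i, hi, rfl⟩)
    -- The coefficient is `g_0 x_i` plus terms containing some `x_k` with `k < i`, which lie in `q`
    -- by induction.
    rw [map_mul, Polynomial.coeff_mul,
      ← Finset.add_sum_erase _ _ (show (0, i) ∈ Finset.HasAntidiagonal.antidiagonal i by
        simp)] at hmem
    have hrest : ∑ a ∈ (Finset.HasAntidiagonal.antidiagonal i).erase (0, i),
        (jetHom s g).coeff a.1 * (jetHom s (X x)).coeff a.2 ∈ q := by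
      refine Ideal.sum_mem _ fun a ha => Ideal.mul_mem_left _ _ ?_
      obtain ⟨hne, ha⟩ := Finset.mem_erase.1 ha
      rw [Finset.HasAntidiagonal.mem_antidiagonal] at ha
      have hlt : a.2 < i := by
        by_contra hcon
        exact hne (Prod.ext (by simp; omega) (by simp; omega))
      exact ih _ hlt (by omega)
    have hprod := (Ideal.add_mem_iff_left _ hrest).1 hmem
    rw [coeff_zero_jetHom] at hprod
    exact ((‹q.IsPrime›).mem_or_mem hprod).resolve_left hg

theorem mem_jetProj_iff {q : PrimeSpectrum (MvPolynomial (JetVar s σ) 𝕜)} {f : MvPolynomial σ 𝕜} :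
    f ∈ (jetProj s q).asIdeal ↔ rename (fun x => ((x, 0) : JetVar s σ)) f ∈ q.asIdeal :=
  Iff.rfl

theorem le_jetProj {I : Ideal (MvPolynomial σ 𝕜)} {q : PrimeSpectrum (MvPolynomial (JetVar s σ) 𝕜)}
    (hq : jetIdeal s I ≤ q.asIdeal) : I ≤ (jetProj s q).asIdeal := fun f hf => by
  rw [mem_jetProj_iff, ← coeff_zero_jetHom]
  exact hq (Ideal.subset_span ⟨f, hf, 0, Nat.zero_le _, rfl⟩)

/-- The support of the generic point of `J_s` of the coordinate subspace of `F`. -/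
def jetFinset (s : ℕ) (F : Finset σ) : Finset (JetVar s σ) := F ×ˢ Finset.univ

theorem mem_jetFinset {F : Finset σ} {v : JetVar s σ} : v ∈ jetFinset s F ↔ v.1 ∈ F := by
  simp [jetFinset]

/-- The kernel of `𝕜[X] → O_{Z,p}` is prime, as the regular ring `O_{Z,p}` is a domain, so it
contains some `faceIdeal 𝕜 F`. Each `x ∉ F` is then killed by some `g` not vanishing at `p`, and
`X_mem_of_mul_mem` applies. -/
theorem exists_faceIdeal_le_of_notMem_singularLocus [Finite σ] {Δ : SimplicialComplex σ}
    {q : PrimeSpectrum (MvPolynomial (JetVar s σ) 𝕜)}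
    (hq : q ∈ jetLocus s (Δ.stanleyReisnerIdeal 𝕜))
    (hsing : jetProj s q ∉ singularLocus (Δ.stanleyReisnerIdeal 𝕜)) :
    ∃ F ∈ Δ.faces, faceIdeal 𝕜 (jetFinset s F) ≤ q.asIdeal := by
  set I := Δ.stanleyReisnerIdeal 𝕜
  have hq' : jetIdeal s I.radical ≤ q.asIdeal := hq
  obtain ⟨p, hp⟩ : jetProj s q ∈ Set.range (PrimeSpectrum.comap (Ideal.Quotient.mk I.radical)) := by
    rw [range_comap_of_surjective _ _ Ideal.Quotient.mk_surjective, Ideal.mk_ker]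
    exact le_jetProj hq'
  have hreg : IsRegularLocalRing (Localization.AtPrime p.asIdeal) := by
    by_contra hcon
    exact hsing ⟨p, hcon, hp⟩
  have := IsRegularLocalRing.isDomain (Localization.AtPrime p.asIdeal)
  set φ := (algebraMap _ (Localization.AtPrime p.asIdeal)).comp (Ideal.Quotient.mk I.radical)
    with hφ
  have hK : (RingHom.ker φ).IsPrime := RingHom.ker_isPrime φ
  have hIK : I ≤ RingHom.ker φ := fun f hf => by
    rw [RingHom.mem_ker, hφ, RingHom.comp_apply,
      Ideal.Quotient.eq_zero_iff_mem.2 (Ideal.le_radical hf), map_zero]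
  obtain ⟨F, hF, hFK⟩ := exists_faceIdeal_le hK hIK
  refine ⟨F, hF, Ideal.span_le.2 ?_⟩
  rintro _ ⟨⟨x, j⟩, hx, rfl⟩
  have hx0 : φ (X x) = 0 := hFK (X_mem_faceIdeal_iff.2 (by simpa [mem_jetFinset] using hx))
  obtain ⟨⟨g, hg⟩, hgx⟩ := (IsLocalization.map_eq_zero_iff p.asIdeal.primeCompl _ _).1 hx0
  obtain ⟨g, rfl⟩ := Ideal.Quotient.mk_surjective g
  refine X_mem_of_mul_mem (I := I.radical) hq' (g := g) ?_ ?_ j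
  · rw [← Ideal.Quotient.eq_zero_iff_mem, map_mul]
    exact hgx
  · rw [← mem_jetProj_iff, ← hp]
    exact hg

theorem jetIdeal_le_faceIdeal {Δ : SimplicialComplex σ} {F : Finset σ} (hF : F ∈ Δ.faces) :
    jetIdeal s (Δ.stanleyReisnerIdeal 𝕜) ≤ faceIdeal 𝕜 (jetFinset s F) := by
  have h : Δ.stanleyReisnerIdeal 𝕜 ≤
      ((faceIdeal 𝕜 (jetFinset s F)).map Polynomial.C).comap (jetHom (𝕜 := 𝕜) (X := σ) s) := by
    refine Ideal.span_le.2 ?_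
    rintro _ ⟨G, hG, rfl⟩
    obtain ⟨x, hxG, hxF⟩ : ∃ x ∈ G, x ∉ F := by
      by_contra! hcon
      exact hG (Δ.down_closed hF hcon)
    rw [SetLike.mem_coe, Ideal.mem_comap, map_prod]
    refine Ideal.mem_of_dvd _ (Finset.dvd_prod_of_mem _ hxG) ?_
    rw [jetHom_X]
    refine Ideal.sum_mem _ fun j _ => Ideal.mul_mem_right _ _ (Ideal.mem_map_of_mem _ ?_)
    exact X_mem_faceIdeal_iff.2 (by simpa [mem_jetFinset] using hxF)
  refine Ideal.span_le.2 ?_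
  rintro _ ⟨f, hf, j, -, rfl⟩
  exact Ideal.mem_map_C_iff.1 (h hf) j

theorem jetProj_faceIdeal (F : Finset σ) :
    (jetProj s ⟨faceIdeal 𝕜 (jetFinset s F), inferInstance⟩).asIdeal = faceIdeal 𝕜 F := by
  have hinj : Function.Injective (fun x : σ => ((x, 0) : JetVar s σ)) := fun x y h =>
    congrArg Prod.fst h
  refine le_antisymm (fun f hf => mem_faceIdeal_iff.2 fun m hm hmF => ?_) (Ideal.span_le.2 ?_)
  · refine mem_faceIdeal_iff.1 (mem_jetProj_iff.1 hf)
      (m.mapDomain fun x : σ => ((x, 0) : JetVar s σ)) ?_ ?_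
    · rw [mem_support_iff, coeff_rename_mapDomain _ hinj]
      exact mem_support_iff.1 hm
    · classical
      refine Finsupp.mapDomain_support.trans fun v hv => ?_
      obtain ⟨x, hx, rfl⟩ := Finset.mem_image.1 hv
      exact mem_jetFinset.2 (hmF hx)
  · rintro _ ⟨x, hx, rfl⟩
    rw [SetLike.mem_coe, mem_jetProj_iff, rename_X]
    exact X_mem_faceIdeal_iff.2 (by simpa [mem_jetFinset] using hx)

/-- For `x ∉ F` the set `insert x F` is a nonface, so `x` is annihilated by the product of the
variables in `F`, a unit at this point. The local ring is therefore a field. -/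
theorem faceIdeal_notMem_singularLocus [Finite σ] {Δ : SimplicialComplex σ} {F : Finset σ}
    (hF : Maximal (· ∈ Δ.faces) F) :
    (⟨faceIdeal 𝕜 F, inferInstance⟩ : PrimeSpectrum (MvPolynomial σ 𝕜)) ∉
      singularLocus (Δ.stanleyReisnerIdeal 𝕜) := by
  classical
  set I := Δ.stanleyReisnerIdeal 𝕜
  rintro ⟨p, hp, hpF⟩
  refine hp ?_
  have hmem : ∀ f, Ideal.Quotient.mk I.radical f ∈ p.asIdeal ↔ f ∈ faceIdeal 𝕜 F := fun f =>
    iff_of_eq (congrArg (fun P : PrimeSpectrum _ => f ∈ P.asIdeal) hpF)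
  have hbot : IsLocalRing.maximalIdeal (Localization.AtPrime p.asIdeal) = ⊥ := by
    rw [← Localization.AtPrime.map_eq_maximalIdeal, eq_bot_iff, Ideal.map_le_iff_le_comap]
    intro f hf
    obtain ⟨f, rfl⟩ := Ideal.Quotient.mk_surjective f
    have hle : faceIdeal 𝕜 F ≤ RingHom.ker ((algebraMap _ (Localization.AtPrime p.asIdeal)).comp
        (Ideal.Quotient.mk I.radical)) := by
      refine Ideal.span_le.2 ?_
      rintro _ ⟨x, hx, rfl⟩
      have hxF : x ∉ F := hx
      refine (IsLocalization.map_eq_zero_iff p.asIdeal.primeCompl _ _).2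
        ⟨⟨Ideal.Quotient.mk I.radical (∏ y ∈ F, X y), fun h => ?_⟩, ?_⟩
      · obtain ⟨y, hy, hyF⟩ := (isPrime_faceIdeal F).prod_mem_iff.1 ((hmem _).1 h)
        exact X_mem_faceIdeal_iff.1 hyF hy
      · rw [← map_mul, Ideal.Quotient.eq_zero_iff_mem, mul_comm, ← Finset.prod_insert hxF]
        refine Ideal.le_radical (Ideal.subset_span ⟨insert x F, fun h => ?_, rfl⟩)
        exact hxF (hF.le_of_ge h (Finset.subset_insert x F) (Finset.mem_insert_self x F))
    exact hle ((hmem f).1 hf)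
  have : IsNoetherianRing (Localization.AtPrime p.asIdeal) :=
    IsLocalization.isNoetherianRing p.asIdeal.primeCompl _ inferInstance
  rw [isRegularLocalRing_iff, hbot, Submodule.spanFinrank_bot,
    ringKrullDim_eq_zero_of_isField (IsLocalRing.isField_iff_maximalIdeal_eq.2 hbot)]
  rfl

/-- The complex of principal jets: a set of jet variables is a face if the variables of `σ` which
occur in it form a face of `Δ`. -/
def SimplicialComplex.jets (Δ : SimplicialComplex σ) (s : ℕ) : SimplicialComplex (JetVar s σ) where
  faces := {G | ∃ F ∈ Δ.faces, G ⊆ jetFinset s F}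
  empty_mem := ⟨∅, Δ.empty_mem, Finset.empty_subset _⟩
  down_closed := fun ⟨F, hF, hGF⟩ h => ⟨F, hF, h.trans hGF⟩

/-- For `≤`, test at the generic points of the jet spaces of the facets; for `≥`, every jet over a
regular point lies in the jet space of some face. -/
theorem principalJets_stanleyReisnerIdeal [Finite σ] (Δ : SimplicialComplex σ) (s : ℕ) :
    principalJets s (Δ.stanleyReisnerIdeal 𝕜) = (Δ.jets s).stanleyReisnerIdeal 𝕜 := by
  rw [principalJets, PrimeSpectrum.vanishingIdeal_closure]
  refine le_antisymm (fun f hf => ?_) (fun f hf => ?_)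
  · rw [PrimeSpectrum.mem_vanishingIdeal] at hf
    refine mem_stanleyReisnerIdeal_iff.2 fun m hm ⟨F, hF, hmF⟩ => ?_
    obtain ⟨G, hFG, hG⟩ := exists_facet hF
    have hfG := hf ⟨faceIdeal 𝕜 (jetFinset s G), inferInstance⟩ ⟨?_, ?_⟩
    · exact mem_faceIdeal_iff.1 hfG m hm fun v hv =>
        mem_jetFinset.2 (hFG (mem_jetFinset.1 (hmF hv)))
    · rw [jetLocus, (isRadical_stanleyReisnerIdeal Δ).radical]
      exact jetIdeal_le_faceIdeal hG.prop
    · rw [Set.mem_preimage, PrimeSpectrum.ext (y := ⟨faceIdeal 𝕜 G, inferInstance⟩)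
        (jetProj_faceIdeal G)]
      exact faceIdeal_notMem_singularLocus hG
  · rw [PrimeSpectrum.mem_vanishingIdeal]
    rintro q ⟨hq, hsing⟩
    obtain ⟨F, hF, hle⟩ := exists_faceIdeal_le_of_notMem_singularLocus hq hsing
    exact hle (stanleyReisnerIdeal_le_faceIdeal (Δ := Δ.jets s) ⟨F, hF, subset_rfl⟩ hf)

end Jets

end PrincipalJets

namespace PrincipalJets
open MvPolynomial

/-! ### Krull dimension -/

section Dimension
variable {σ : Type*} [Finite σ] {𝕜 : Type*} [Field 𝕜]

theorem ringKrullDim_quotient_faceIdeal (F : Finset σ) :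
    ringKrullDim (MvPolynomial σ 𝕜 ⧸ faceIdeal 𝕜 F) = (F.card : ℕ) := by
  rw [ringKrullDim_eq_of_ringEquiv (quotientFaceIdealEquiv F),
    MvPolynomial.ringKrullDim_of_isNoetherianRing, ringKrullDim_eq_zero_of_field, zero_add]
  simp

theorem ringKrullDim_quotient_stanleyReisnerIdeal {Δ : SimplicialComplex σ} {d : ℕ}
    (hd : ∃ F ∈ Δ.faces, F.card = d) (hle : ∀ F ∈ Δ.faces, F.card ≤ d) :
    ringKrullDim (MvPolynomial σ 𝕜 ⧸ Δ.stanleyReisnerIdeal 𝕜) = d := by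
  refine le_antisymm ?_ ?_
  · rw [ringKrullDim_quotient]
    -- The smallest prime of the chain contains some `faceIdeal 𝕜 F`, so the whole chain lives in
    -- one coordinate subspace.
    refine iSup_le fun l => ?_
    obtain ⟨F, hF, hFl⟩ := exists_faceIdeal_le l.head.1.2 l.head.2
    let l' : LTSeries (PrimeSpectrum.zeroLocus (R := MvPolynomial σ 𝕜) (faceIdeal 𝕜 F)) :=
      { length := l.length
        toFun := fun i => ⟨(l i).1, hFl.trans (LTSeries.head_le l i)⟩
        step := fun i => l.step i }
    have h := Order.LTSeries.length_le_krullDim l'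
    rw [← ringKrullDim_quotient, ringKrullDim_quotient_faceIdeal] at h
    exact h.trans (by exact_mod_cast hle F hF)
  · obtain ⟨F, hF, rfl⟩ := hd
    rw [← ringKrullDim_quotient_faceIdeal (𝕜 := 𝕜) F]
    exact ringKrullDim_le_of_surjective
      (Ideal.Quotient.factor (stanleyReisnerIdeal_le_faceIdeal hF))
      (Ideal.Quotient.factor_surjective _)

end Dimension

/-! ### Hilbert series and multiplicity -/

section Hilbert
variable {σ : Type*} [Fintype σ] [DecidableEq σ] {𝕜 : Type*} [Field 𝕜]

open Classical in
/-- The exponents of degree `n` whose support is a face. -/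
def faceExponents (Δ : SimplicialComplex σ) (n : ℕ) : Finset (σ →₀ ℕ) :=
  (Finset.finsuppAntidiag Finset.univ n).filter fun m => m.support ∈ Δ.faces

theorem mem_faceExponents {Δ : SimplicialComplex σ} {n : ℕ} {m : σ →₀ ℕ} :
    m ∈ faceExponents Δ n ↔ m.degree = n ∧ m.support ∈ Δ.faces := by
  simp [faceExponents, Finset.mem_finsuppAntidiag, Finsupp.degree_eq_sum]

/-- The monomials whose support is a face form a basis of the quotient. -/
theorem hilbertFunction_stanleyReisnerIdeal (Δ : SimplicialComplex σ) (n : ℕ) :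
    hilbertFunction (Δ.stanleyReisnerIdeal 𝕜) n = (faceExponents Δ n).card := by
  set I := Δ.stanleyReisnerIdeal 𝕜
  set v : faceExponents Δ n → MvPolynomial σ 𝕜 ⧸ I :=
    fun m => Ideal.Quotient.mkₐ 𝕜 I (monomial m.1 1)
  have hspan : (homogeneousSubmodule σ 𝕜 n).map (Ideal.Quotient.mkₐ 𝕜 I).toLinearMap =
      Submodule.span 𝕜 (Set.range v) := by
    refine le_antisymm ?_ (Submodule.span_le.2 ?_)
    · rw [Submodule.map_le_iff_le_comap]
      intro f hf
      rw [Submodule.mem_comap, f.as_sum, map_sum]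
      refine Submodule.sum_mem _ fun m hm => ?_
      rw [show monomial m (coeff m f) = coeff m f • monomial m (1 : 𝕜) by
        rw [smul_monomial, smul_eq_mul, mul_one], map_smul]
      refine Submodule.smul_mem _ _ ?_
      by_cases hface : m.support ∈ Δ.faces
      · refine Submodule.subset_span ⟨⟨m, mem_faceExponents.2 ⟨?_, hface⟩⟩, rfl⟩
        have := (mem_homogeneousSubmodule n f).1 hf (mem_support_iff.1 hm)
        rw [Finsupp.degree_eq_weight_one]
        exact this
      · have h0 : (monomial m (1 : 𝕜)) ∈ I := mem_stanleyReisnerIdeal_iff.2 fun m' hm' => by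
          rwa [Finset.mem_singleton.1 (support_monomial_subset hm')]
        have h1 : (Ideal.Quotient.mkₐ 𝕜 I).toLinearMap (monomial m (1 : 𝕜)) = 0 :=
          Ideal.Quotient.eq_zero_iff_mem.2 h0
        rw [h1]
        exact zero_mem _
    · rintro _ ⟨m, rfl⟩
      refine ⟨_, ?_, rfl⟩
      exact isHomogeneous_monomial 1 (mem_faceExponents.1 m.2).1
  have hli : LinearIndependent 𝕜 v := by
    rw [Fintype.linearIndependent_iff]
    intro c hc m
    have hmem : ∑ m, c m • monomial m.1 (1 : 𝕜) ∈ I := by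
      rw [← Ideal.Quotient.eq_zero_iff_mem, ← Ideal.Quotient.mkₐ_eq_mk 𝕜, map_sum, ← hc]
      exact Finset.sum_congr rfl fun m _ => map_smul _ _ _
    by_contra hcm
    refine mem_stanleyReisnerIdeal_iff.1 hmem m.1 ?_ (mem_faceExponents.1 m.2).2
    rw [mem_support_iff, coeff_sum, Finset.sum_eq_single m]
    · simpa using hcm
    · intro m' _ hne
      rw [coeff_smul, coeff_monomial, if_neg (fun h => hne (Subtype.ext h)), smul_zero]
    · simp
  rw [hilbertFunction, hspan, finrank_span_eq_card hli, Fintype.card_coe]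

/-- Each variable in `F` has a positive exponent and contributes a factor `t + t ^ 2 + ⋯`. -/
theorem card_filter_support_eq (F : Finset σ) (n : ℕ) :
    (((Finset.finsuppAntidiag Finset.univ n).filter fun m => m.support = F).card : ℤ) =
      PowerSeries.coeff n ((PowerSeries.mk fun i => if i ≠ 0 then (1 : ℤ) else 0) ^ F.card) := by
  rw [← Finset.prod_const, PowerSeries.coeff_prod]
  simp only [PowerSeries.coeff_mk, Finset.prod_boole]
  trans (((Finset.finsuppAntidiag F n).filter fun m => ∀ x ∈ F, m x ≠ 0).card : ℤ)
  swap
  · rw [← Finset.sum_boole]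
    exact Finset.sum_congr rfl fun l _ => by congr
  congr 2
  ext m
  simp only [Finset.mem_filter, Finset.mem_finsuppAntidiag, Finset.subset_univ, and_true]
  constructor
  · rintro ⟨hm, rfl⟩
    refine ⟨⟨?_, subset_rfl⟩, fun x hx => by simpa using hx⟩
    rw [← hm]
    exact Finset.sum_subset (Finset.subset_univ _) fun x _ hx => by simpa using hx
  · rintro ⟨⟨hm, hsub⟩, hpos⟩
    refine ⟨?_, hsub.antisymm fun x hx => by simpa using hpos x hx⟩
    rw [← hm]
    exact (Finset.sum_subset (Finset.subset_univ _) fun x _ hx => by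
      simpa using fun h => hx (hsub (Finsupp.mem_support_iff.2 h))).symm

open Classical in
theorem hilbertSeries_stanleyReisnerIdeal (Δ : SimplicialComplex σ) :
    hilbertSeries (Δ.stanleyReisnerIdeal 𝕜) =
      ∑ F : Finset σ with F ∈ Δ.faces,
        (PowerSeries.mk fun i => if i ≠ 0 then (1 : ℤ) else 0) ^ F.card := by
  ext n
  rw [hilbertSeries, PowerSeries.coeff_mk, hilbertFunction_stanleyReisnerIdeal, map_sum,
    Finset.card_eq_sum_card_fiberwise (f := Finsupp.support)
      (t := Finset.univ.filter (· ∈ Δ.faces))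
      (fun m hm => by simpa using (mem_faceExponents.1 hm).2)]
  push_cast
  refine Finset.sum_congr rfl fun F hF => ?_
  rw [← card_filter_support_eq, faceExponents, Finset.filter_filter]
  congr 2
  refine Finset.filter_congr fun m _ => ⟨fun h => h.2, fun h => ⟨?_, h⟩⟩
  rw [h]
  exact (Finset.mem_filter.1 hF).2

theorem mk_ite_mul_one_sub_X :
    (PowerSeries.mk fun i => if i ≠ 0 then (1 : ℤ) else 0) * (1 - PowerSeries.X) =
      PowerSeries.X := by
  have h : (PowerSeries.mk fun i => if i ≠ 0 then (1 : ℤ) else 0) =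
      PowerSeries.X * PowerSeries.mk fun _ => (1 : ℤ) := by
    ext n
    cases n <;> simp [PowerSeries.coeff_succ_X_mul]
  rw [h, mul_assoc]
  exact (congrArg _ (PowerSeries.mk_one_mul_one_sub_eq_one ℤ)).trans (mul_one _)

open Classical in
-- The Hilbert series is the sum of `(t / (1 - t)) ^ |F|` over the faces. After clearing `(1 - t) ^
-- d`, only the faces with `d` elements survive at `t = 1`.
theorem hasMultiplicity_stanleyReisnerIdeal {Δ : SimplicialComplex σ} {d : ℕ}
    (hd : ∃ F ∈ Δ.faces, F.card = d) (hle : ∀ F ∈ Δ.faces, F.card ≤ d) :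
    HasMultiplicity (Δ.stanleyReisnerIdeal 𝕜) (Δ.fVector d) := by
  refine ⟨d, ringKrullDim_quotient_stanleyReisnerIdeal hd hle,
    ∑ F : Finset σ with F ∈ Δ.faces, Polynomial.X ^ F.card * (1 - Polynomial.X) ^ (d - F.card),
    ?_, ?_⟩
  · rw [hilbertSeries_stanleyReisnerIdeal, Finset.sum_mul,
      ← Polynomial.coeToPowerSeries.ringHom_apply, map_sum]
    refine Finset.sum_congr rfl fun F hF => ?_
    rw [Polynomial.coeToPowerSeries.ringHom_apply]
    push_cast
    nth_rw 2 [← mk_ite_mul_one_sub_X]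
    rw [mul_pow, mul_assoc, ← pow_add, Nat.add_sub_cancel' (hle F (Finset.mem_filter.1 hF).2)]
  · rw [Polynomial.eval_finsetSum, SimplicialComplex.fVector, Set.ncard_eq_toFinset_card',
      Finset.card_eq_sum_ones, Nat.cast_sum, Set.toFinset_ofPred, ← Finset.filter_filter,
      Finset.sum_filter (fun F : Finset σ => F.card = d)]
    refine Finset.sum_congr rfl fun F hF => ?_
    have := hle F (Finset.mem_filter.1 hF).2
    simp only [Polynomial.eval_mul, Polynomial.eval_pow, Polynomial.eval_X, Polynomial.eval_sub,
      Polynomial.eval_one, one_pow, sub_self, one_mul]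
    split_ifs with h
    · simp [h]
    · rw [zero_pow (by omega)]

end Hilbert

/-! ### The f-vector of the complex of principal jets -/

section FVector
variable {σ : Type*} {s : ℕ}

theorem mem_jets_faces_iff [DecidableEq σ] {Δ : SimplicialComplex σ}
    {G : Finset (JetVar s σ)} : G ∈ (Δ.jets s).faces ↔ G.image Prod.fst ∈ Δ.faces := by
  constructor
  · rintro ⟨F, hF, hG⟩
    refine Δ.down_closed hF (Finset.image_subset_iff.2 fun v hv => mem_jetFinset.1 (hG hv))
  · exact fun h => ⟨_, h, fun v hv => mem_jetFinset.2 (Finset.mem_image_of_mem _ hv)⟩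

/-- The lifting function counts families of nonempty subsets. -/
theorem liftingFunction_eq_card (s j k : ℕ) :
    liftingFunction s j k = (Finset.univ.filter fun B : Fin j → Finset (Fin (s + 1)) =>
      (∀ h, (B h).Nonempty) ∧ ∑ h, (B h).card = k).card := by
  -- Sort the families by their tuple of sizes `a`; the product of binomials counts those of sizes
  -- `a`.
  rw [liftingFunction, Finset.card_eq_sum_card_fiberwise (f := fun B h => (B h).card)
    (t := (Finset.finAntidiagonal j k).filter (fun a => ∀ h, 0 < a h))]
  · refine Finset.sum_congr rfl fun a ha => ?_
    rw [Finset.mem_filter, Finset.mem_finAntidiagonal] at ha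
    have : ∏ h : Fin j, (s + 1).choose (a h) =
        (Fintype.piFinset fun h => Finset.powersetCard (a h)
          (Finset.univ : Finset (Fin (s + 1)))).card := by
      simp [Fintype.card_piFinset]
    rw [this]
    congr 1
    ext B
    simp only [Fintype.mem_piFinset, Finset.mem_powersetCard, Finset.subset_univ, true_and,
      Finset.mem_filter, Finset.mem_univ, funext_iff]
    refine ⟨fun h => ⟨⟨fun i => ?_, ?_⟩, h⟩, fun h => h.2⟩
    · rw [← Finset.card_pos, h]
      exact ha.2 i
    · simpa [h] using ha.1
  · intro B hB
    simpa [Finset.card_pos, and_comm] using hB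

/-- `G` is determined by its fibres over the points of `F`, and it projects onto all of `F` exactly
when they are nonempty. -/
theorem card_filter_image_fst_eq [Fintype σ] [DecidableEq σ] (F : Finset σ) (k : ℕ) :
    (Finset.univ.filter fun G : Finset (JetVar s σ) => G.image Prod.fst = F ∧ G.card = k).card =
      liftingFunction s F.card k := by
  rw [liftingFunction_eq_card]
  symm
  set e := F.equivFin.symm
  let ι : (Σ _ : Fin F.card, Fin (s + 1)) ↪ JetVar s σ :=
    ⟨fun v => ((e v.1 : σ), v.2), by
      rintro ⟨a, b⟩ ⟨a', b'⟩ h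
      simp only [Prod.mk.injEq] at h
      obtain rfl := e.injective (Subtype.ext h.1)
      rw [h.2]⟩
  have hι : ∀ (B : Fin F.card → Finset (Fin (s + 1))) (h c),
      ((e h : σ), c) ∈ (Finset.univ.sigma B).map ι ↔ c ∈ B h := fun B h c => by
    rw [show ((e h : σ), c) = ι ⟨h, c⟩ from rfl, Finset.mem_map']
    simp
  refine Finset.card_bij (fun B _ => (Finset.univ.sigma B).map ι) ?_ ?_ ?_
  · intro B hB
    obtain ⟨hne, hcard⟩ := (Finset.mem_filter.1 hB).2
    refine Finset.mem_filter.2 ⟨Finset.mem_univ _, ?_, by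
      rw [Finset.card_map, Finset.card_sigma, hcard]⟩
    ext x
    rw [Finset.mem_image]
    constructor
    · rintro ⟨_, hv, rfl⟩
      obtain ⟨v, -, rfl⟩ := Finset.mem_map.1 hv
      exact (e v.1).2
    · intro hx
      obtain ⟨h, hh⟩ := e.surjective ⟨x, hx⟩
      obtain ⟨c, hc⟩ := hne h
      exact ⟨_, (hι B h c).2 hc, by rw [hh]⟩
  · intro B _ B' _ hBB
    funext h
    ext c
    rw [← hι B, ← hι B', hBB]
  · intro G hG
    obtain ⟨hGF, hcard⟩ := (Finset.mem_filter.1 hG).2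
    have hmap : (Finset.univ.sigma fun h => Finset.univ.filter fun c => ((e h : σ), c) ∈ G).map ι =
        G := by
      ext ⟨x, c⟩
      constructor
      · intro hv
        obtain ⟨⟨h, c'⟩, hv, heq⟩ := Finset.mem_map.1 hv
        rw [← heq]
        exact (Finset.mem_filter.1 (Finset.mem_sigma.1 hv).2).2
      · intro hv
        have hx : x ∈ F := hGF ▸ Finset.mem_image_of_mem Prod.fst hv
        obtain ⟨h, hh⟩ := e.surjective ⟨x, hx⟩
        have hxe : x = (e h : σ) := by rw [hh]
        subst hxe
        simpa [hι] using hv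
    refine ⟨_, Finset.mem_filter.2 ⟨Finset.mem_univ _, fun h => ?_, ?_⟩, hmap⟩
    · have hx : (e h : σ) ∈ G.image Prod.fst := hGF ▸ (e h).2
      obtain ⟨⟨x, c⟩, hv, hxe⟩ := Finset.mem_image.1 hx
      simp only at hxe
      subst hxe
      exact ⟨c, by simpa using hv⟩
    · rw [← Finset.card_sigma, ← Finset.card_map ι, hmap, hcard]

open Classical in
-- Group the faces of Γ by their projection `F`, then the `F` by size.
theorem fVector_jets [Fintype σ] (Δ : SimplicialComplex σ) (s : ℕ) :
    (Δ.jets s).fVector = rowMul Δ.fVector (liftingMatrix s) := by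
  funext k
  have hsupp : (Function.support fun j => Δ.fVector j * liftingMatrix s j k) ⊆
      (Finset.range (Fintype.card σ + 1) : Finset ℕ) := fun j hj => by
    obtain ⟨F, -, hF⟩ := Set.nonempty_of_ncard_ne_zero (left_ne_zero_of_mul hj)
    simpa [← hF, Nat.lt_succ_iff] using Finset.card_le_univ F
  rw [rowMul, finsum_eq_sum_of_support_subset _ hsupp]
  have h1 : (Δ.jets s).fVector k =
      ∑ F : Finset σ with F ∈ Δ.faces, liftingFunction s F.card k := by
    rw [SimplicialComplex.fVector, Set.ncard_eq_toFinset_card', Set.toFinset_ofPred,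
      Finset.card_eq_sum_card_fiberwise (f := Finset.image Prod.fst)
        (t := Finset.univ.filter (· ∈ Δ.faces))
        (fun G hG => by simpa using mem_jets_faces_iff.1 (Finset.mem_filter.1 hG).2.1)]
    refine Finset.sum_congr rfl fun F hF => ?_
    rw [← card_filter_image_fst_eq, Finset.filter_filter]
    congr 1
    refine Finset.filter_congr fun G _ => ⟨fun h => ⟨h.2, h.1.2⟩, fun h => ⟨⟨?_, h.2⟩, h.1⟩⟩
    rw [mem_jets_faces_iff, h.1]
    exact (Finset.mem_filter.1 hF).2
  rw [h1, ← Finset.sum_fiberwise_of_maps_to (g := Finset.card)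
    (t := Finset.range (Fintype.card σ + 1))
    (fun F _ => by simpa [Nat.lt_succ_iff] using Finset.card_le_univ F)]
  refine Finset.sum_congr rfl fun j _ => ?_
  rw [Finset.sum_congr rfl (g := fun _ => liftingFunction s j k)
    (fun F hF => by rw [(Finset.mem_filter.1 hF).2]), Finset.sum_const, smul_eq_mul,
    SimplicialComplex.fVector, Set.ncard_eq_toFinset_card', Set.toFinset_ofPred,
    Finset.filter_filter]
  rfl

theorem card_jetFinset (F : Finset σ) : (jetFinset s F).card = (s + 1) * F.card := by
  rw [jetFinset, Finset.card_product, Finset.card_univ, Fintype.card_fin, mul_comm]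

theorem card_le_of_mem_jets {Δ : SimplicialComplex σ} {d : ℕ} (hle : ∀ F ∈ Δ.faces, F.card ≤ d) :
    ∀ G ∈ (Δ.jets s).faces, G.card ≤ (s + 1) * d := by
  rintro G ⟨F, hF, hG⟩
  refine (Finset.card_le_card hG).trans ?_
  rw [card_jetFinset]
  exact Nat.mul_le_mul_left _ (hle F hF)

/-- A face of this size inside `jetFinset s F` must fill it, by counting, so `jetFinset s` is a
bijection between the faces counted. -/
theorem fVector_jets_top {Δ : SimplicialComplex σ} {d : ℕ} (hle : ∀ F ∈ Δ.faces, F.card ≤ d) :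
    (Δ.jets s).fVector ((s + 1) * d) = Δ.fVector d := by
  have hinj : Function.Injective (jetFinset (σ := σ) s) := fun F F' h => by
    ext x
    rw [← mem_jetFinset (s := s) (v := (x, 0)), h, mem_jetFinset]
  rw [SimplicialComplex.fVector, SimplicialComplex.fVector,
    ← Set.ncard_image_of_injective _ hinj]
  congr 1
  ext G
  constructor
  · rintro ⟨⟨F, hF, hG⟩, hcard⟩
    have hd := hle F hF
    have hFG := Finset.card_le_card hG
    rw [card_jetFinset, hcard] at hFG
    have hFd : F.card = d := le_antisymm hd (Nat.le_of_mul_le_mul_left hFG s.succ_pos)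
    exact ⟨F, ⟨hF, hFd⟩, (Finset.eq_of_subset_of_card_le hG
      (by rw [card_jetFinset, hcard, hFd])).symm⟩
  · rintro ⟨F, ⟨hF, rfl⟩, rfl⟩
    exact ⟨⟨F, hF, subset_rfl⟩, card_jetFinset F⟩

end FVector

end PrincipalJets

end

theorem mainTheorem6 {𝕜 : Type*} [Field 𝕜] {X : Type*} [Finite X]
    (Δ : PrincipalJets.SimplicialComplex X) (I : Ideal (MvPolynomial X 𝕜))
    (hI : I = Δ.stanleyReisnerIdeal 𝕜) (s : ℕ) :
    (∃ Γ : PrincipalJets.SimplicialComplex (PrincipalJets.JetVar s X),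
      PrincipalJets.principalJets s I = Γ.stanleyReisnerIdeal 𝕜 ∧
      Γ.fVector = PrincipalJets.rowMul Δ.fVector (PrincipalJets.liftingMatrix s)) ∧
    ∃ d : ℕ,
      ringKrullDim (MvPolynomial X 𝕜 ⧸ I) = d ∧
      ringKrullDim (MvPolynomial (PrincipalJets.JetVar s X) 𝕜 ⧸
        PrincipalJets.principalJets s I) = ((s + 1) * d : ℕ) ∧
      PrincipalJets.HasMultiplicity I (Δ.fVector d) ∧
      PrincipalJets.HasMultiplicity (PrincipalJets.principalJets s I) (Δ.fVector d) := by
  classical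
  have := Fintype.ofFinite X
  subst hI
  obtain ⟨F, hF, hmax⟩ := Set.exists_max_image Δ.faces Finset.card (Set.toFinite _)
    ⟨∅, Δ.empty_mem⟩
  have hd : ∃ G ∈ Δ.faces, G.card = F.card := ⟨F, hF, rfl⟩
  have hd' : ∃ G ∈ (Δ.jets s).faces, G.card = (s + 1) * F.card :=
    ⟨_, ⟨F, hF, subset_rfl⟩, PrincipalJets.card_jetFinset F⟩
  have hmax' := PrincipalJets.card_le_of_mem_jets (s := s) hmax
  rw [PrincipalJets.principalJets_stanleyReisnerIdeal]
  refine ⟨⟨_, rfl, PrincipalJets.fVector_jets Δ s⟩, F.card,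
    PrincipalJets.ringKrullDim_quotient_stanleyReisnerIdeal hd hmax,
    PrincipalJets.ringKrullDim_quotient_stanleyReisnerIdeal hd' hmax',
    PrincipalJets.hasMultiplicity_stanleyReisnerIdeal hd hmax, ?_⟩
  rw [← PrincipalJets.fVector_jets_top (s := s) hmax]
  exact PrincipalJets.hasMultiplicity_stanleyReisnerIdeal hd' hmax'
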